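/- Let $\Gamma$ be a finitely generated abelian group and let $F\colon\Gamma\to\Gamma$ be an injective group endomorphism. For an endomorphism $G$ of $\Gamma$, a finite subset $\Sigma\subseteq\Gamma$ is called a $G$-spanning set for $\Gamma$ if: (i) every $a\in\Gamma$ can be written as $a=s_0+Gs_1+\cdots+G^ns_n$ for some $n\ge 0$ and $s_0,\dots,s_n\in\Sigma$; (ii) $0\in\Sigma$, and $-a\in\Sigma$ whenever $a\in\Sigma$; (iii) if $a_1,\dots,a_5\in\Sigma$, then $a_1+\cdots+a_5\in\Sigma+G\Sigma$; (iv) if $a_1,a_2,a_3\in\Sigma$ and $a_1+a_2+a_3\in G\Gamma$, then $a_1+a_2+a_3\in G\Sigma$. Theorem. There exist an integer $r>0$ and an $F^r$-spanning set for $\Gamma$ if and only if every eigenvalue of the $\mathbb{C}$-linear map $F\otimes_{\mathbb{Z}}\mathrm{id}_{\mathbb{C}}$ on $\Gamma\otimes_{\mathbb{Z}}\mathbb{C}$ has modulus greater than $1$. -/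

import Mathlib

open scoped TensorProduct

/-- The value `[s₀ s₁ ⋯ sₙ]_F = s₀ + F s₁ + ⋯ + Fⁿ sₙ` of a string of elements of `Γ`
(the empty string has value `0`). -/
def wordValue {Γ : Type*} [AddCommGroup Γ] (F : AddMonoid.End Γ) (w : List Γ) : Γ :=
  ∑ i : Fin w.length, (F ^ (i : ℕ)) (w.get i)

/-- A finite subset `S` of `Γ` is an `F`-spanning set for `Γ`. -/
structure IsSpanningSet {Γ : Type*} [AddCommGroup Γ] (F : AddMonoid.End Γ)
    (S : Finset Γ) : Prop where
  exists_word : ∀ a : Γ, ∃ w : List Γ, (∀ s ∈ w, s ∈ S) ∧ a = wordValue F w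
  zero_mem : (0 : Γ) ∈ S
  neg_mem : ∀ a ∈ S, -a ∈ S
  add_five : ∀ a₁ ∈ S, ∀ a₂ ∈ S, ∀ a₃ ∈ S, ∀ a₄ ∈ S, ∀ a₅ ∈ S,
    ∃ s ∈ S, ∃ t ∈ S, a₁ + a₂ + a₃ + a₄ + a₅ = s + F t
  add_three : ∀ a₁ ∈ S, ∀ a₂ ∈ S, ∀ a₃ ∈ S,
    (∃ b : Γ, a₁ + a₂ + a₃ = F b) → ∃ t ∈ S, a₁ + a₂ + a₃ = F t

/-- The `ℂ`-linear endomorphism of the complexification of `Γ` induced by `F`.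
Mathlib writes the extended scalars on the left, so `F ⊗ id_ℂ` on `Γ ⊗ ℂ` appears
as `id_ℂ ⊗ F` on `ℂ ⊗ Γ`. -/
noncomputable def complexified {Γ : Type*} [AddCommGroup Γ] (F : AddMonoid.End Γ) :
    Module.End ℂ (ℂ ⊗[ℤ] Γ) :=
  LinearMap.baseChange ℂ (AddMonoidHom.toIntLinearMap F)

/-!
Eigenvalues are handled on the dual side: `μ` is an eigenvalue of `F ⊗ id_ℂ` exactly when some
nonzero additive map `φ : Γ → ℂ` satisfies `φ (F a) = μ * φ a` (`complexified_hasEigenvalue_iff`).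
In this form nothing has to be transported between `Γ`, its quotient by torsion and `ℂ ⊗ Γ`.

Suppose `S` is a spanning set for `G = F ^ r`, and let `φ` be an eigenfunctional of `G` with
eigenvalue `μ`. Adding two words digit by digit, with carries in `S` supplied by the condition on
sums of five elements, gives a word longer by one letter
(`IsSpanningSet.add_add_mem_wordsOfLength`). So `2 ^ k • a` is a word of length `n + k + 1`. If
`‖μ‖ ≤ 1`, then `φ` is bounded by a constant times the length of a word, whereas
`φ (2 ^ k • a) = 2 ^ k * φ a` grows exponentially. Hence `1 < ‖μ‖` (`IsSpanningSet.one_lt_norm`).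

Conversely, coordinates modulo torsion give `φ : Γ → ℂⁿ` with `φ (F a) = A (φ a)` for a matrix `A`
(`exists_coordinates`). All eigenvalues of `A` lie outside the closed unit disc, so `A⁻¹` has
spectral radius less than one and, by Gelfand's formula, some power `A ^ r` expands the norm by a
factor `6` (`exists_pow_expanding`). Since `F ^ r` is injective, its image has finite index, and a
ball in `Γ` that contains representatives of all cosets is a spanning set
(`exists_isSpanningSet_of_expanding`).
-/

open Filter Topology

/-! ### Eigenvalues and eigenfunctionals -/

/-- In finite dimension `f - μ` fails to be injective exactly when its range lies in a hyperplane,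
so eigenvalues may be tested on eigenfunctionals in place of eigenvectors. -/
theorem Module.End.hasEigenvalue_iff_exists_dual {K V : Type*} [Field K] [AddCommGroup V]
    [Module K V] [FiniteDimensional K V] (f : Module.End K V) (μ : K) :
    f.HasEigenvalue μ ↔ ∃ φ : V →ₗ[K] K, φ ≠ 0 ∧ ∀ v, φ (f v) = μ * φ v := by
  have key : f.HasEigenvalue μ ↔ ¬ Function.Surjective (f - algebraMap K (Module.End K V) μ) := by
    rw [Module.End.hasEigenvalue_iff, Module.End.eigenspace_def, ne_eq, LinearMap.ker_eq_bot,
      LinearMap.injective_iff_surjective, Algebra.algebraMap_eq_smul_one]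
  rw [key, ← LinearMap.range_eq_top]
  constructor
  · intro h
    obtain ⟨φ, hφ, hle⟩ := Submodule.exists_le_ker_of_lt_top _ (lt_top_iff_ne_top.2 h)
    refine ⟨φ, hφ, fun v => ?_⟩
    have := hle (LinearMap.mem_range_self _ v)
    simpa [sub_eq_zero] using this
  · rintro ⟨φ, hφ, h⟩ htop
    refine hφ (LinearMap.ext fun v => ?_)
    obtain ⟨w, rfl⟩ := LinearMap.range_eq_top.1 htop v
    simp [h]

section

variable {Γ : Type*} [AddCommGroup Γ]

/-- The eigenvalues of the complexification of `F` are the eigenvalues of precomposition with `F`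
on the additive maps `Γ → ℂ`. -/
theorem complexified_hasEigenvalue_iff [AddGroup.FG Γ] (F : AddMonoid.End Γ) (μ : ℂ) :
    (complexified F).HasEigenvalue μ ↔
      ∃ φ : Γ →+ ℂ, φ ≠ 0 ∧ ∀ a, φ (F a) = μ * φ a := by
  have : Module.Finite ℤ Γ := Module.Finite.iff_addGroup_fg.2 inferInstance
  rw [Module.End.hasEigenvalue_iff_exists_dual]
  constructor
  · rintro ⟨ψ, hψ, h⟩
    refine ⟨ψ.toAddMonoidHom.comp (TensorProduct.mk ℤ ℂ Γ 1).toAddMonoidHom, fun h0 => hψ ?_,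
      fun a => h ((1 : ℂ) ⊗ₜ[ℤ] a)⟩
    ext a
    exact DFunLike.congr_fun h0 a
  · rintro ⟨φ, hφ, h⟩
    have hval (z : ℂ) (a : Γ) :
        TensorProduct.AlgebraTensorModule.lift
          (LinearMap.toSpanSingleton ℂ (Γ →ₗ[ℤ] ℂ) φ.toIntLinearMap) (z ⊗ₜ[ℤ] a) = z * φ a := by
      simp
    refine ⟨TensorProduct.AlgebraTensorModule.lift
        (LinearMap.toSpanSingleton ℂ (Γ →ₗ[ℤ] ℂ) φ.toIntLinearMap), fun h0 => hφ ?_, fun v => ?_⟩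
    · ext a
      rw [← one_mul (φ a), ← hval, h0, LinearMap.zero_apply, AddMonoidHom.zero_apply]
    · induction v with
      | zero => simp
      | tmul z a =>
        have hF : complexified F (z ⊗ₜ[ℤ] a) = z ⊗ₜ[ℤ] F a := LinearMap.baseChange_tmul ..
        rw [hF, hval, hval, h]
        ring
      | add x y hx hy => simp only [map_add, hx, hy, mul_add]

/-! ### A spanning set forces expansion -/

@[simp]
theorem wordValue_nil (F : AddMonoid.End Γ) : wordValue F [] = 0 := by
  simp [wordValue]

@[simp]
theorem wordValue_cons (F : AddMonoid.End Γ) (s : Γ) (w : List Γ) :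
    wordValue F (s :: w) = s + F (wordValue F w) := by
  simp [wordValue, Fin.sum_univ_succ, map_sum, ← Function.iterate_succ_apply',
    -Function.iterate_succ]

/-- The set of values `s₀ + G s₁ + ⋯ + Gⁿ sₙ` of words of length exactly `n + 1` in `S`. -/
def wordsOfLength (G : AddMonoid.End Γ) (S : Finset Γ) : ℕ → Set Γ
  | 0 => S
  | n + 1 => {x | ∃ s ∈ S, ∃ y ∈ wordsOfLength G S n, x = s + G y}

theorem IsSpanningSet.exists_mem_wordsOfLength {G : AddMonoid.End Γ} {S : Finset Γ}
    (h : IsSpanningSet G S) (a : Γ) : ∃ n, a ∈ wordsOfLength G S n := by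
  obtain ⟨w, hw, rfl⟩ := h.exists_word a
  induction w with
  | nil => exact ⟨0, by simpa [wordsOfLength] using h.zero_mem⟩
  | cons s w ih =>
    obtain ⟨n, hn⟩ := ih fun t ht => hw t (List.mem_cons_of_mem _ ht)
    exact ⟨n + 1, s, hw s List.mem_cons_self, _, hn, wordValue_cons G s w⟩

/-- Addition with a carry `c`: the sum of two words is a word with just one more letter. -/
theorem IsSpanningSet.add_add_mem_wordsOfLength {G : AddMonoid.End Γ} {S : Finset Γ}
    (h : IsSpanningSet G S) {n : ℕ} {x y c : Γ} (hx : x ∈ wordsOfLength G S n)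
    (hy : y ∈ wordsOfLength G S n) (hc : c ∈ S) : x + y + c ∈ wordsOfLength G S (n + 1) := by
  have add_three' (a b c : Γ) (ha : a ∈ S) (hb : b ∈ S) (hc : c ∈ S) :
      ∃ s ∈ S, ∃ t ∈ S, a + b + c = s + G t := by
    simpa using h.add_five a ha b hb c hc 0 h.zero_mem 0 h.zero_mem
  induction n generalizing x y c with
  | zero => exact add_three' x y c hx hy hc
  | succ n ih =>
    obtain ⟨s, hs, x, hx, rfl⟩ := hx
    obtain ⟨t, ht, y, hy, rfl⟩ := hy
    obtain ⟨u, hu, v, hv, huv⟩ := add_three' s t c hs ht hc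
    refine ⟨u, hu, _, ih hx hy hv, ?_⟩
    calc s + G x + (t + G y) + c = (s + t + c) + (G x + G y) := by abel
      _ = u + G (x + y + v) := by rw [huv, map_add, map_add]; abel

/-- Doubling lengthens a word by one letter, so `2 ^ k • a` is a word of length `O(k)`. An
eigenfunctional for an eigenvalue in the closed unit disc is at most linear in the length, which is
incompatible with its taking the value `2 ^ k * φ a` at `2 ^ k • a`. -/
theorem IsSpanningSet.one_lt_norm {G : AddMonoid.End Γ} {S : Finset Γ} (h : IsSpanningSet G S)
    {φ : Γ →+ ℂ} (hφ : φ ≠ 0) {μ : ℂ} (hμ : ∀ a, φ (G a) = μ * φ a) : 1 < ‖μ‖ := by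
  by_contra! hle
  obtain ⟨a, ha⟩ := DFunLike.ne_iff.1 hφ
  obtain ⟨n, hn⟩ := h.exists_mem_wordsOfLength a
  obtain ⟨C, hC⟩ := (S.finite_toSet.image fun s => ‖φ s‖).bddAbove
  have hC' (s : Γ) (hs : s ∈ S) : ‖φ s‖ ≤ C := hC ⟨s, hs, rfl⟩
  have bound (m : ℕ) : ∀ x ∈ wordsOfLength G S m, ‖φ x‖ ≤ (m + 1) * C := by
    induction m with
    | zero => intro x hx; simpa using hC' x hx
    | succ m ih =>
      rintro _ ⟨s, hs, y, hy, rfl⟩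
      have h1 : ‖μ * φ y‖ ≤ ‖φ y‖ := by
        rw [norm_mul]; exact mul_le_of_le_one_left (norm_nonneg _) hle
      calc ‖φ (s + G y)‖ = ‖φ s + μ * φ y‖ := by rw [map_add, hμ]
        _ ≤ ‖φ s‖ + ‖μ * φ y‖ := norm_add_le _ _
        _ ≤ C + (m + 1) * C := add_le_add (hC' s hs) (h1.trans (ih y hy))
        _ = ((m + 1 : ℕ) + 1) * C := by push_cast; ring
  have double (k : ℕ) : 2 ^ k • a ∈ wordsOfLength G S (n + k) := by
    induction k with
    | zero => simpa using hn
    | succ k ih =>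
      have := h.add_add_mem_wordsOfLength ih ih h.zero_mem
      rwa [add_zero, ← two_nsmul, ← mul_nsmul', ← pow_succ'] at this
  have grow (k : ℕ) : 2 ^ k * ‖φ a‖ ≤ (n + 1 + k) * C := by
    have := bound _ _ (double k)
    rw [map_nsmul, nsmul_eq_mul, norm_mul] at this
    simp only [Nat.cast_pow, Nat.cast_ofNat, norm_pow, Complex.norm_ofNat, Nat.cast_add] at this
    linarith
  have lim : Tendsto (fun k : ℕ => (n + 1 + k : ℝ) * C / 2 ^ k) atTop (𝓝 0) := by
    have h1 := (tendsto_pow_const_div_const_pow_of_one_lt 0 (one_lt_two (α := ℝ))).const_mul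
      ((n + 1) * C)
    have h2 := (tendsto_pow_const_div_const_pow_of_one_lt 1 (one_lt_two (α := ℝ))).const_mul C
    convert! h1.add h2 using 2
    · ring
    · simp
  have : ‖φ a‖ ≤ 0 := ge_of_tendsto' lim fun k => by
    rw [le_div_iff₀ (by positivity), mul_comm]
    exact grow k
  exact ha (norm_le_zero_iff.1 this)

/-! ### Expansion gives a spanning set -/

/-- An injective endomorphism of a finitely generated abelian group has finite cokernel: the
cokernel has rank zero. -/
theorem finite_quotient_range_of_injective [AddGroup.FG Γ] (G : AddMonoid.End Γ)
    (hG : Function.Injective G) : Finite (Γ ⧸ LinearMap.range (AddMonoidHom.toIntLinearMap G)) := by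
  have : Module.Finite ℤ Γ := Module.Finite.iff_addGroup_fg.2 inferInstance
  set g : Γ →ₗ[ℤ] Γ := AddMonoidHom.toIntLinearMap G
  have h1 := Submodule.finrank_quotient_add_finrank (LinearMap.range g)
  have h2 : Module.finrank ℤ (LinearMap.range g) = Module.finrank ℤ Γ :=
    LinearMap.finrank_range_of_inj hG
  have h3 : Module.finrank ℤ (Γ ⧸ LinearMap.range g) = 0 := by omega
  exact Module.finite_of_fg_torsion _ (Module.finrank_eq_zero_iff_isTorsion.1 h3)

/-- If `G` expands a norm-like function with finite balls by a factor `6`, then a ball which meets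
every coset of the image of `G` is a spanning set: five elements of the ball and a representative
of a coset have a sum of size at most `6` times the radius. -/
theorem exists_isSpanningSet_of_expanding {E : Type*} [SeminormedAddCommGroup E] (φ : Γ →+ E)
    (hfin : ∀ R : ℝ, {a | ‖φ a‖ ≤ R}.Finite) (G : AddMonoid.End Γ)
    (hexp : ∀ a, 6 * ‖φ a‖ ≤ ‖φ (G a)‖)
    (hcoker : Finite (Γ ⧸ LinearMap.range (AddMonoidHom.toIntLinearMap G))) :
    ∃ S : Finset Γ, IsSpanningSet G S := by
  obtain ⟨R, hR, hrep⟩ : ∃ R : ℝ, 0 < R ∧ ∀ a, ∃ s t, ‖φ s‖ ≤ R ∧ a = s + G t := by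
    obtain ⟨C, hC⟩ := (Set.finite_range fun q : Γ ⧸ LinearMap.range
      (AddMonoidHom.toIntLinearMap G) => ‖φ q.out‖).bddAbove
    refine ⟨max C 1, by positivity, fun a => ?_⟩
    have hmem : a - (Submodule.Quotient.mk a : Γ ⧸ LinearMap.range
        (AddMonoidHom.toIntLinearMap G)).out ∈
        LinearMap.range (AddMonoidHom.toIntLinearMap G) := by
      rw [← Submodule.Quotient.eq]
      exact (Quotient.out_eq _).symm
    obtain ⟨t, ht⟩ := hmem
    refine ⟨_, t, (hC (Set.mem_range_self (Submodule.Quotient.mk a))).trans (le_max_left _ _), ?_⟩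
    exact (eq_add_of_sub_eq' ht.symm)
  have hquot (s t a : Γ) (h : a = s + G t) : 6 * ‖φ t‖ ≤ ‖φ a‖ + ‖φ s‖ := by
    have hGt : φ (G t) = φ a - φ s := by rw [h, map_add, add_sub_cancel_left]
    exact (hexp t).trans (hGt ▸ norm_sub_le _ _)
  have hmem (a : Γ) : a ∈ (hfin R).toFinset ↔ ‖φ a‖ ≤ R := by simp
  refine ⟨(hfin R).toFinset, ?_, ?_, ?_, ?_, ?_⟩
  · have main (k : ℕ) : ∀ a, ‖φ a‖ ≤ 2 ^ k * R →
        ∃ w : List Γ, (∀ s ∈ w, s ∈ (hfin R).toFinset) ∧ a = wordValue G w := by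
      induction k with
      | zero => exact fun a ha => ⟨[a], by simpa using ha, by simp⟩
      | succ k ih =>
        intro a ha
        obtain ⟨s, t, hs, hst⟩ := hrep a
        have ht := hquot s t a hst
        have hk : R ≤ 2 ^ k * R := le_mul_of_one_le_left hR.le (one_le_pow₀ one_le_two)
        obtain ⟨w, hw, rfl⟩ := ih t (by rw [pow_succ] at ha; linarith [norm_nonneg (φ t)])
        exact ⟨s :: w, by simpa [hs] using hw, by simpa using hst⟩
    intro a
    obtain ⟨k, hk⟩ := pow_unbounded_of_one_lt (‖φ a‖ / R) (one_lt_two (α := ℝ))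
    exact main k a ((div_lt_iff₀ hR).1 hk).le
  · simpa using hR.le
  · intro a ha
    simpa using ha
  · intro a₁ h₁ a₂ h₂ a₃ h₃ a₄ h₄ a₅ h₅
    simp only [hmem] at *
    obtain ⟨s, t, hs, hst⟩ := hrep (a₁ + a₂ + a₃ + a₄ + a₅)
    refine ⟨s, hs, t, ?_, hst⟩
    have ht := hquot s t _ hst
    simp only [map_add] at ht
    have := norm_add₄_le (a := φ a₁) (b := φ a₂) (c := φ a₃) (d := φ a₄)
    linarith [norm_add_le (φ a₁ + φ a₂ + φ a₃ + φ a₄) (φ a₅)]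
  · rintro a₁ h₁ a₂ h₂ a₃ h₃ ⟨b, hb⟩
    simp only [hmem] at *
    refine ⟨b, ?_, hb⟩
    have ht := hquot 0 b (a₁ + a₂ + a₃) (by rw [hb, zero_add])
    simp only [map_add, map_zero, norm_zero] at ht
    linarith [norm_add₃_le (a := φ a₁) (b := φ a₂) (c := φ a₃)]

/-! ### Coordinates on a finitely generated abelian group -/

/-- The coordinates of `Γ` modulo torsion with respect to a basis, viewed in `ℂⁿ`: only finitely
many elements have bounded coordinates, every standard basis vector occurs, and endomorphisms of
`Γ` act by matrices because they preserve the torsion subgroup. -/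
theorem exists_coordinates (Γ : Type*) [AddCommGroup Γ] [AddGroup.FG Γ] :
    ∃ (n : ℕ) (φ : Γ →+ (Fin n → ℂ)), (∀ R : ℝ, {a | ‖φ a‖ ≤ R}.Finite) ∧
      (∀ i, ∃ a, φ a = Pi.single i 1) ∧
      ∀ F : AddMonoid.End Γ, ∃ A : Matrix (Fin n) (Fin n) ℂ, ∀ a, φ (F a) = A.mulVec (φ a) := by
  obtain ⟨n, ι, _, p, hp, e, ⟨f⟩⟩ := AddCommGroup.equiv_free_prod_directSum_zmod Γ
  have (i : ι) : NeZero (p i ^ e i) := ⟨pow_ne_zero _ (hp i).ne_zero⟩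
  have hT : Finite (DirectSum ι fun i => ZMod (p i ^ e i)) := by
    classical
    exact Finite.of_injective _ DFunLike.coe_injective
  set φ : Γ →+ (Fin n → ℂ) :=
    { toFun := fun a i => ((f a).1 i : ℂ)
      map_zero' := by ext; simp
      map_add' := fun a b => by ext; simp }
  have hφ_apply (a : Γ) (i : Fin n) : φ a i = ((f a).1 i : ℂ) := rfl
  -- The kernel of `φ` is the torsion subgroup, which every endomorphism preserves.
  have hker (F : AddMonoid.End Γ) (a : Γ) (ha : φ a = 0) : φ (F a) = 0 := by
    have h1 : (f a).1 = 0 := by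
      ext i
      simpa [hφ_apply] using congrFun ha i
    obtain ⟨m, hm, hma⟩ := isOfFinAddOrder_iff_nsmul_eq_zero.1
      (isOfFinAddOrder_of_finite (f a).2)
    have h2 : m • a = 0 := f.injective (by
      rw [map_nsmul, map_zero]
      exact Prod.ext (by simp [h1]) (by simpa using hma))
    have h3 : m • φ (F a) = 0 := by rw [← map_nsmul, ← map_nsmul, h2, map_zero, map_zero]
    exact (smul_eq_zero.1 h3).resolve_left hm.ne'
  have hsec (i : Fin n) : φ (f.symm (Finsupp.single i 1, 0)) = Pi.single i 1 := by
    ext j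
    simp [hφ_apply, Finsupp.single_apply, Pi.single_apply, eq_comm]
  refine ⟨n, φ, fun R => ?_, fun i => ⟨_, hsec i⟩, fun F => ?_⟩
  · have hbox : {g : Fin n → ℤ | ∀ i, g i ∈ Set.Icc (-⌈R⌉) ⌈R⌉}.Finite :=
      Set.Finite.pi' fun _ => Set.finite_Icc _ _
    have hinj : Function.Injective fun a => ((⇑(f a).1, (f a).2) :
        (Fin n → ℤ) × DirectSum ι fun i => ZMod (p i ^ e i)) := fun a b hab =>
      f.injective (Prod.ext (DFunLike.coe_injective (Prod.ext_iff.1 hab).1)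
        (Prod.ext_iff.1 hab).2)
    refine ((hbox.prod Set.finite_univ).preimage hinj.injOn).subset
      fun a ha => ⟨fun i => ?_, Set.mem_univ _⟩
    have h1 : |((f a).1 i : ℝ)| ≤ R := by
      rw [← Complex.norm_intCast]
      exact (norm_le_pi_norm (φ a) i).trans ha
    have h2 := abs_le.1 (h1.trans (Int.le_ceil R))
    exact ⟨by exact_mod_cast h2.1, by exact_mod_cast h2.2⟩
  · refine ⟨Matrix.of fun i j => φ (F (f.symm (Finsupp.single j 1, 0))) i, fun a => ?_⟩
    have h1 : φ (a - ∑ j, (f a).1 j • f.symm (Finsupp.single j 1, 0)) = 0 := by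
      simp only [map_sub, map_sum, map_zsmul, hsec]
      ext i
      simp [hφ_apply, Finset.sum_apply, Pi.single_apply]
    have h2 := hker F _ h1
    rw [map_sub, map_sub, sub_eq_zero] at h2
    rw [h2]
    simp only [map_sum, map_zsmul]
    ext i
    simp only [Finset.sum_apply, Matrix.mulVec, dotProduct, Matrix.of_apply, hφ_apply a,
      Pi.smul_apply]
    exact Finset.sum_congr rfl fun j _ => by rw [zsmul_eq_mul, mul_comm]

/-! ### Powers of matrices -/

open scoped ENNReal NNReal in
/-- A consequence of Gelfand's formula for the spectral radius. -/
theorem tendsto_pow_of_spectrum_lt_one {A : Type*} [NormedRing A] [NormedAlgebra ℂ A]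
    [CompleteSpace A] (a : A) (h : ∀ z ∈ spectrum ℂ a, ‖z‖ < 1) :
    Tendsto (fun n => a ^ n) atTop (𝓝 0) := by
  have hrad : spectralRadius ℂ a < 1 := by
    rcases (spectrum ℂ a).eq_empty_or_nonempty with h0 | h0
    · simp [spectralRadius, h0]
    · exact_mod_cast spectrum.spectralRadius_lt_of_forall_lt_of_nonempty (r := 1) h0
        fun z hz => by exact_mod_cast h z hz
  obtain ⟨q, hq, hq1⟩ := ENNReal.lt_iff_exists_nnreal_btwn.1 hrad
  have hq1' : q < 1 := by exact_mod_cast hq1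
  have hev := (spectrum.pow_nnnorm_pow_one_div_tendsto_nhds_spectralRadius a).eventually_lt_const hq
  refine squeeze_zero_norm' ?_ (tendsto_pow_atTop_nhds_zero_of_lt_one q.2 (by exact_mod_cast hq1'))
  filter_upwards [hev, eventually_gt_atTop 0] with n hn hn0
  have h1 : ((‖a ^ n‖₊ : ℝ≥0∞) ^ (1 / n : ℝ)) ^ (n : ℝ) ≤ (q : ℝ≥0∞) ^ (n : ℝ) :=
    ENNReal.rpow_le_rpow hn.le (by positivity)
  rw [← ENNReal.rpow_mul, one_div_mul_cancel (by positivity), ENNReal.rpow_one,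
    ENNReal.rpow_natCast] at h1
  exact_mod_cast h1

attribute [local instance] Matrix.linftyOpNormedRing Matrix.linftyOpNormedAlgebra in
/-- A matrix whose eigenvalues lie outside the closed unit disc has a power that expands the
sup norm by a factor `6`: the powers of its inverse tend to zero. -/
theorem exists_pow_expanding {n : ℕ} (A : Matrix (Fin n) (Fin n) ℂ)
    (hA : ∀ z ∈ spectrum ℂ A, 1 < ‖z‖) :
    ∃ r : ℕ, 0 < r ∧ ∀ v, 6 * ‖v‖ ≤ ‖(A ^ r).mulVec v‖ := by
  have hunit : IsUnit A := by
    rw [← spectrum.zero_notMem_iff ℂ]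
    intro h0
    simpa using (hA 0 h0).trans_le' zero_le_one
  obtain ⟨u, rfl⟩ := hunit
  have hlim := tendsto_pow_of_spectrum_lt_one (↑u⁻¹ : Matrix (Fin n) (Fin n) ℂ) fun z hz => by
    rw [← spectrum.map_inv, Set.mem_inv] at hz
    have := hA _ hz
    rw [norm_inv] at this
    exact (one_lt_inv_iff₀.1 this).2
  have hsmall := (tendsto_zero_iff_norm_tendsto_zero.1 hlim).eventually_le_const
    (show (0 : ℝ) < 1 / 6 by norm_num)
  obtain ⟨r, hr, hr0⟩ := (hsmall.and (eventually_gt_atTop 0)).exists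
  refine ⟨r, hr0, fun v => ?_⟩
  have hv : (↑u⁻¹ ^ r : Matrix (Fin n) (Fin n) ℂ).mulVec ((↑u ^ r : Matrix _ _ ℂ).mulVec v) = v := by
    rw [Matrix.mulVec_mulVec, ← Units.val_pow_eq_pow_val, ← Units.val_pow_eq_pow_val,
      ← Units.val_mul, inv_pow, inv_mul_cancel, Units.val_one, Matrix.one_mulVec]
  have h1 := Matrix.linfty_opNorm_mulVec (↑u⁻¹ ^ r : Matrix (Fin n) (Fin n) ℂ)
    ((↑u ^ r : Matrix _ _ ℂ).mulVec v)
  rw [hv] at h1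
  have := h1.trans (mul_le_mul_of_nonneg_right hr (norm_nonneg _))
  linarith

end

theorem mainTheorem5 {Γ : Type*} [AddCommGroup Γ] [AddGroup.FG Γ]
    (F : AddMonoid.End Γ) (hF : Function.Injective F) :
    (∃ r : ℕ, 0 < r ∧ ∃ S : Finset Γ, IsSpanningSet (F ^ r) S) ↔
      ∀ μ : ℂ, Module.End.HasEigenvalue (complexified F) μ → 1 < ‖μ‖ := by
  simp only [complexified_hasEigenvalue_iff]
  constructor
  · rintro ⟨r, hr, S, hS⟩ μ ⟨φ, hφ, hμ⟩
    have hpow (k : ℕ) (a : Γ) : φ ((F ^ k) a) = μ ^ k * φ a := by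
      induction k with
      | zero => simp
      | succ k ih =>
        rw [pow_succ', AddMonoid.End.coe_mul, Function.comp_apply, hμ, ih, pow_succ', mul_assoc]
    have := hS.one_lt_norm hφ (hpow r)
    rw [norm_pow] at this
    exact (one_lt_pow_iff_of_nonneg (norm_nonneg μ) hr.ne').1 this
  · intro h
    obtain ⟨n, φ, hfin, hbasis, hmat⟩ := exists_coordinates Γ
    obtain ⟨A, hA⟩ := hmat F
    have hspec : ∀ z ∈ spectrum ℂ A, 1 < ‖z‖ := by
      intro z hz
      rw [spectrum.mem_iff, Matrix.isUnit_iff_isUnit_det, isUnit_iff_ne_zero, not_not,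
        ← Matrix.exists_vecMul_eq_zero_iff] at hz
      obtain ⟨v, hv, hvz⟩ := hz
      have hvA : Matrix.vecMul v A = z • v := by
        rw [Matrix.vecMul_sub, sub_eq_zero, Algebra.algebraMap_eq_smul_one, Matrix.vecMul_smul,
          Matrix.vecMul_one] at hvz
        exact hvz.symm
      refine h z ⟨⟨⟨fun a => dotProduct v (φ a), by simp⟩, fun a b => by
        simp [dotProduct_add]⟩, fun h0 => hv ?_, fun a => ?_⟩
      · ext i
        obtain ⟨a, ha⟩ := hbasis i
        simpa [ha] using DFunLike.congr_fun h0 a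
      · change dotProduct v (φ (F a)) = z * dotProduct v (φ a)
        rw [hA, Matrix.dotProduct_mulVec, hvA, smul_dotProduct, smul_eq_mul]
    obtain ⟨r, hr, hexp⟩ := exists_pow_expanding A hspec
    have hpow (k : ℕ) (a : Γ) : φ ((F ^ k) a) = (A ^ k).mulVec (φ a) := by
      induction k with
      | zero => simp
      | succ k ih =>
        rw [pow_succ', AddMonoid.End.coe_mul, Function.comp_apply, hA, ih, pow_succ',
          Matrix.mulVec_mulVec]
    have hinj : Function.Injective (F ^ r) := by
      rw [AddMonoid.End.coe_pow]
      exact hF.iterate r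
    exact ⟨r, hr, exists_isSpanningSet_of_expanding φ hfin _
      (fun a => hpow r a ▸ hexp (φ a)) (finite_quotient_range_of_injective _ hinj)⟩
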